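/- Fix integers $n \ge 1$ and $0 \le m_0 < m_1 < \cdots < m_{n-1}$, and let $M := m_0 + \cdots + m_{n-1}$. Let $I \subset \mathbb{R}$ be an interval of positive length, $a \in I$ (for example $I = [a, a+\epsilon)$ or $I = (a-\epsilon, a+\epsilon)$ with $\epsilon > 0$), and let $f : I \to \mathbb{R}$ be $M$ times differentiable at $a$; that is, the derivatives of $f$ of order less than $M$ exist on a neighbourhood of $a$ in $I$, and the one of order $M-1$ is differentiable at $a$ (no condition if $M=0$). Derivatives are taken relative to the domain, hence are one-sided at an endpoint belonging to it. Let $\mathbf{u}, \mathbf{v} \in \mathbb{R}^n$, and let $\delta > 0$ be so small that $a + t u_j v_k \in I$ for all $t \in [0,\delta)$ and all $j,k$ (if $I=[a,a+\epsilon)$, such a $\delta$ exists exactly when all $u_j v_k \ge 0$; if $I=(a-\epsilon,a+\epsilon)$, it always exists). Define $\Delta : [0,\delta) \to \mathbb{R}$ by $$\Delta(t) := \det f[a \mathbf{1}_{n\times n} + t \mathbf{u}\mathbf{v}^T] = \det \bigl( f(a + t u_j v_k) \bigr)_{j,k=1}^n .$$ Then $\Delta$ is $M$ times differentiable at $0$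 and $$\Delta^{(M)}(0) = \sum_{\mathbf{l} \vdash M} \binom{M}{l_0, l_1, \dots, l_{n-1}} V(\mathbf{u}) V(\mathbf{v}) s_{\mathbf{l}}(\mathbf{u}) s_{\mathbf{l}}(\mathbf{v}) \prod_{k=0}^{n-1} f^{(l_k)}(a),$$ where the sum is over all integer tuples $\mathbf{l}$ with $0 \le l_0 \le l_1 \le \cdots \le l_{n-1}$ and $l_0 + \cdots + l_{n-1} = M$, the first factor is the multinomial coefficient, $V(\mathbf{u}) := \prod_{1 \le j<k \le n} (u_k - u_j)$ (so $V(\mathbf{u})=1$ if $n=1$), and $s_{\mathbf{l}}(\mathbf{u})$ is the following Schur polynomial. If $l_0 < \cdots < l_{n-1}$, then $s_{\mathbf{l}}(\mathbf{u}) := \sum_T \prod_{j=1}^n u_j^{f_j(T)}$, where $T$ runs over the Young tableaux with rows of lengths $l_{n-1}-(n-1), \dots, l_1 - 1, l_0$ from top to bottom and with entries in $\{1,\dots,n\}$ that weakly increase along rows and strictly increase down columns, and $f_j(T)$ is the number of cells of $T$ with entry $j$. If two of the $l_k$ are equal, then $s_{\mathbf{l}}(\mathbf{u}) := 0$. In particular,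 $\Delta(0) = \Delta'(0) = \cdots = \Delta^{(N-1)}(0) = 0$, where $N = \binom{n}{2}$. -/

import Mathlib

open Set Filter Topology

/-- `f` is `M` times differentiable at `x`, relative to the set `s`: the derivatives of `f` of
order less than `M` exist on a neighbourhood of `x` in `s`, and the one of order `M - 1` is
differentiable at `x`. There is no condition for `M = 0`. -/
def TimesDiffWithinAt (M : ℕ) (f : ℝ → ℝ) (s : Set ℝ) (x : ℝ) : Prop :=
  (∀ k : ℕ, k + 1 < M →
    ∀ᶠ y in 𝓝[s] x, DifferentiableWithinAt ℝ (iteratedDerivWithin k f s) s y) ∧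
  (∀ k : ℕ, k + 1 = M → DifferentiableWithinAt ℝ (iteratedDerivWithin k f s) s x)

/-- For a strictly increasing tuple `m = (m_0 < ⋯ < m_{N-1})`, the Young diagram whose rows have,
from top to bottom, the lengths `m_{N-1} - (N-1), …, m_1 - 1, m_0 - 0`. -/
def schurShape {N : ℕ} (m : Fin N → ℕ) (hm : StrictMono m) : YoungDiagram where
  cells := (Finset.univ : Finset (Fin N)).biUnion fun r =>
    (Finset.range (m r.rev - r.rev)).image fun c => ((r : ℕ), c)
  isLowerSet := by
    have key : ∀ d : ℕ, ∀ i j : Fin N, (j : ℕ) = i + d → m i + d ≤ m j := by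
      intro d
      induction d with
      | zero =>
        intro i j h
        have : i = j := Fin.ext (by omega)
        simp [this]
      | succ d ih =>
        intro i j h
        have h1 := ih i ⟨i + d, by omega⟩ rfl
        have h2 : m ⟨i + d, by omega⟩ < m j := hm (by rw [Fin.lt_def]; simp; omega)
        omega
    rintro ⟨r, c⟩ ⟨p, q⟩ hle hrc
    simp only [Finset.coe_biUnion, Finset.coe_image, Set.mem_iUnion, Set.mem_image,
      Finset.coe_range, Set.mem_Iio, Prod.mk.injEq, Finset.coe_univ, Set.mem_univ,
      exists_true_left] at hrc ⊢
    obtain ⟨s, d, hd, hs, rfl⟩ := hrc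
    obtain ⟨hp, hq⟩ := Prod.mk_le_mk.mp hle
    have hpN : p < N := by have := s.isLt; omega
    refine ⟨⟨p, hpN⟩, q, ?_, rfl, rfl⟩
    have := key ((s : ℕ) - p) s.rev (Fin.rev ⟨p, hpN⟩) (by simp only [Fin.val_rev]; omega)
    simp only [Fin.val_rev] at hd this ⊢
    omega

/-- Column-strict Young tableaux of shape `μ` with entries in a set of `k` letters, namely
`0, 1, …, k - 1`. -/
def BoundedTableau (μ : YoungDiagram) (k : ℕ) : Type :=
  {T : SemistandardYoungTableau μ // ∀ i j : ℕ, (i, j) ∈ μ → T i j < k}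

instance (μ : YoungDiagram) (k : ℕ) : Finite (BoundedTableau μ k) := by
  refine Finite.of_injective
    (fun (T : BoundedTableau μ k) (c : μ.cells) =>
      (⟨T.1 c.1.1 c.1.2, T.2 _ _ c.2⟩ : Fin k)) ?_
  intro S T h
  refine Subtype.ext (SemistandardYoungTableau.ext fun i j => ?_)
  by_cases hc : (i, j) ∈ μ
  · simpa using congrFun h ⟨(i, j), hc⟩
  · rw [S.1.zeros hc, T.1.zeros hc]

/-- The weight `∏_j u_j ^ (number of cells with entry j)` of a tableau. -/
def BoundedTableau.weight {R : Type*} [CommRing R] {μ : YoungDiagram} {k : ℕ}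
    (T : BoundedTableau μ k) (u : Fin k → R) : R :=
  ∏ j : Fin k, u j ^ (μ.cells.filter fun c => T.1 c.1 c.2 = (j : ℕ)).card

open Classical in
/-- The Schur polynomial `s_m(u)` of a weakly increasing tuple `m = (m_0 ≤ ⋯ ≤ m_{N-1})`, a finite
sum over tableaux; it is `0` if two of the entries of `m` coincide. -/
noncomputable def schurPoly {R : Type*} [CommRing R] {N k : ℕ} (m : Fin N → ℕ) (u : Fin k → R) :
    R :=
  if hm : StrictMono m then ∑ᶠ T : BoundedTableau (schurShape m hm) k, T.weight u else 0

/-- The Vandermonde product `∏_{j < k} (u_k - u_j)`. -/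
def vandermondeProd {R : Type*} [CommRing R] {n : ℕ} (u : Fin n → R) : R :=
  ∏ j : Fin n, ∏ k ∈ Finset.Ioi j, (u k - u j)

open Classical in
/-- The partitions of `M` into at most `n` parts, padded by zeros and written as weakly increasing
tuples `(m_0 ≤ ⋯ ≤ m_{n-1})`. -/
noncomputable def partitionTuples (n M : ℕ) : Finset (Fin n → ℕ) :=
  (Finset.piAntidiag Finset.univ M).filter fun m => Monotone m

/-- `Δ(t) = det f[a 1_{n × n} + t u vᵀ]`, where `f` acts entrywise. -/
noncomputable def entrywiseDet {n : ℕ} (f : ℝ → ℝ) (a : ℝ) (u v : Fin n → ℝ) (t : ℝ) : ℝ :=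
  ((Matrix.of fun _ _ : Fin n => a) + t • Matrix.vecMulVec u v).map f |>.det

/-! Attach to each `t` the formal series in `X` whose coefficients are the divided derivatives of `s
↦ f (a + s c)` at `t`, with `c = u_i v_j`. Up to order `M`, differentiating a coefficient in `t`
agrees with taking that coefficient of the `X`-derivative. Since `d/dX` is a derivation, this
property (`IsJetWithinAt`) passes through sums and products, hence through determinants. So the
`k`-th derivative of `Δ` at `0`, for `k ≤ M`, is `k!` times the `X^k` coefficient of one formal
determinant, and no differentiability beyond order `M` is used.

That coefficient is a Cauchy–Binet sum of products of alternants over strictly increasing exponent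
tuples (`coeff_det_mk_pow`). Each alternant is a Vandermonde product times a Schur polynomial
(`det_pow_eq_vandermondeProd_mul_schurPoly`), because alternants and tableau sums obey the same
recursion when the last variable is split off. Strictly increasing tuples have sum at least
`n.choose 2`, so the lower derivatives vanish. -/

/-! ### Alternants: splitting off the last variable -/

section Alternant

variable {R : Type*} [CommRing R]

/-- Determinants are multilinear in the columns. -/
theorem det_of_sum_columns {n : ℕ} {κ : Type*} (t : Fin n → Finset κ)
    (A : Fin n → Fin n → κ → R) :
    Matrix.det (Matrix.of fun i k => ∑ x ∈ t k, A i k x) =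
      ∑ μ ∈ Fintype.piFinset t, Matrix.det (Matrix.of fun i k => A i k (μ k)) := by
  simp only [Matrix.det_apply', Matrix.of_apply, Finset.prod_univ_sum, Finset.mul_sum]
  exact Finset.sum_comm

/-- Branching rule for alternants: the last variable is split off. -/
theorem det_pow_succ (U : ℕ → R) {n : ℕ} (l : Fin (n + 1) → ℕ) (hl : StrictMono l) :
    Matrix.det (Matrix.of fun i j : Fin (n + 1) => U i ^ l j) =
      (∏ j ∈ Finset.range n, (U n - U j)) *
        ∑ μ ∈ Fintype.piFinset fun k : Fin n => Finset.Ico (l k.castSucc) (l k.succ),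
          U n ^ (l 0 + ∑ k : Fin n, (l k.succ - 1 - μ k)) *
            Matrix.det (Matrix.of fun i j : Fin n => U i ^ μ j) := by
  have hle : ∀ k : Fin n, l k.castSucc ≤ l k.succ := fun k => hl.monotone (Fin.castSucc_le_succ k)
  -- Subtract from each column `U n ^ gap` times its predecessor. The last row then vanishes outside
  -- column `0`, and the remaining entries are divisible by `U i - U n`, with geometric sums as
  -- quotients.
  let B : Matrix (Fin (n + 1)) (Fin (n + 1)) R := Matrix.of fun i =>
    Fin.cons (U i ^ l 0) fun k : Fin n =>
      U i ^ l k.succ - U i ^ l k.castSucc * U n ^ (l k.succ - l k.castSucc)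
  have hAB : Matrix.det (Matrix.of fun i j : Fin (n + 1) => U i ^ l j) = B.det := by
    apply Matrix.det_eq_of_forall_col_eq_smul_add_pred
      (fun k : Fin n => U n ^ (l k.succ - l k.castSucc))
    · intro i; simp [B]
    · intro i j; simp [B]; ring
  have hlast : ∀ k : Fin n, B (Fin.last n) k.succ = 0 := by
    intro k
    simp only [B, Matrix.of_apply, Fin.cons_succ, Fin.val_last]
    rw [← pow_add, Nat.add_sub_cancel' (hle k), sub_self]
  have hsub : B.submatrix (Fin.last n).succAbove (0 : Fin (n + 1)).succAbove =
      Matrix.of fun i k : Fin n => (U i - U n) * Matrix.of (fun (i k : Fin n) =>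
        ∑ x ∈ Finset.Ico (l k.castSucc) (l k.succ), U i ^ x * U n ^ (l k.succ - 1 - x)) i k := by
    ext i k
    simp only [B, Matrix.submatrix_apply, Matrix.of_apply, Fin.succAbove_last,
      Fin.succAbove_zero, Fin.cons_succ, Fin.val_castSucc]
    rw [mul_geom_sum₂_Ico _ _ (hle k)]
  rw [hAB, Matrix.det_succ_row B (Fin.last n), Fin.sum_univ_succ]
  simp only [hlast, mul_zero, zero_mul, Finset.sum_const_zero, add_zero]
  rw [hsub, Matrix.det_mul_column, det_of_sum_columns]
  have hB0 : B (Fin.last n) 0 = U n ^ l 0 := by simp [B]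
  rw [hB0]
  -- The cofactor sign reverses all `n` differences.
  have hprod : ((-1 : R) ^ ((Fin.last n : ℕ) + ((0 : Fin (n + 1)) : ℕ))) *
      ∏ i : Fin n, (U i - U n) = ∏ j ∈ Finset.range n, (U n - U j) := by
    rw [← Fin.prod_univ_eq_prod_range (fun j => U n - U j)]
    have : ((-1 : R) ^ ((Fin.last n : ℕ) + ((0 : Fin (n + 1)) : ℕ))) = ∏ _i : Fin n, (-1 : R) := by
      simp
    rw [this, ← Finset.prod_mul_distrib]
    exact Finset.prod_congr rfl fun i _ => by ring
  rw [← hprod]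
  simp only [Finset.mul_sum]
  refine Finset.sum_congr rfl fun μ _ => ?_
  have hcol : Matrix.det (Matrix.of fun i k : Fin n => U i ^ μ k * U n ^ (l k.succ - 1 - μ k)) =
      (∏ k, U n ^ (l k.succ - 1 - μ k)) * Matrix.det (Matrix.of fun i k : Fin n => U i ^ μ k) := by
    rw [← Matrix.det_mul_row]
    congr 1; ext i k; simp [mul_comm]
  rw [hcol, Finset.prod_pow_eq_pow_sum, pow_add]
  ring

end Alternant

/-! ### Tableaux: removing the cells with the largest entry -/

section Tableaux

/-- Column-strict tableaux, as functions, whose `i`-th row has length `L i`, with entries below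
`k`. -/
def tableauFunctions (L : ℕ → ℕ) (k : ℕ) : Set (ℕ → ℕ → ℕ) :=
  {T | (∀ i j, j < L i → T i j < k) ∧ (∀ i j₁ j₂, j₁ < j₂ → j₂ < L i → T i j₁ ≤ T i j₂) ∧
    (∀ i₁ i₂ j, i₁ < i₂ → j < L i₂ → T i₁ j < T i₂ j) ∧ ∀ i j, L i ≤ j → T i j = 0}

/-- Extend a tableau of shape `L'` to shape `L` by cells with entry `k`. -/
def extendTableau (L L' : ℕ → ℕ) (k : ℕ) (T : ℕ → ℕ → ℕ) : ℕ → ℕ → ℕ := fun i j =>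
  if j < L' i then T i j else if j < L i then k else 0

/-- By `h₁` a cell lying above any cell of the larger shape is in the inner shape, so its entry is
below `k` and columns stay strict. -/
theorem extendTableau_mem {L L' : ℕ → ℕ} {k : ℕ} {T : ℕ → ℕ → ℕ} (hL : Antitone L)
    (h₁ : ∀ i, L (i + 1) ≤ L' i) (h₂ : ∀ i, L' i ≤ L i) (hT : T ∈ tableauFunctions L' k) :
    extendTableau L L' k T ∈ tableauFunctions L (k + 1) := by
  obtain ⟨hb, hr, hc, hz⟩ := hT
  refine ⟨fun i j hj => ?_, fun i j₁ j₂ hj hj₂ => ?_, fun i₁ i₂ j hi hj => ?_, fun i j hj => ?_⟩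
  · simp only [extendTableau]
    split_ifs with h
    · exact (hb i j h).trans (Nat.lt_succ_self k)
    · exact Nat.lt_succ_self k
  · simp only [extendTableau]
    by_cases h : j₂ < L' i
    · rw [if_pos h, if_pos (hj.trans h)]
      exact hr i j₁ j₂ hj h
    · rw [if_neg h, if_pos hj₂]
      split_ifs with h' h''
      · exact (hb i j₁ h').le
      · exact le_rfl
      · exact Nat.zero_le _
  · have hj₁ : j < L' i₁ := hj.trans_le ((hL hi).trans (h₁ i₁))
    simp only [extendTableau]
    rw [if_pos hj₁]
    split_ifs with h
    · exact hc i₁ i₂ j hi h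
    · exact hb i₁ j hj₁
  · simp only [extendTableau]
    rw [if_neg (not_lt.2 ((h₂ i).trans hj)), if_neg (not_lt.2 hj)]

/-- The inner shape is recovered as the cells with entry below `k`; hence extensions from different
inner shapes never coincide. -/
theorem extendTableau_lt_iff {L L' : ℕ → ℕ} {k : ℕ} {T : ℕ → ℕ → ℕ}
    (h₂ : ∀ i, L' i ≤ L i) (hT : T ∈ tableauFunctions L' k) (i j : ℕ) :
    j < L' i ↔ j < L i ∧ extendTableau L L' k T i j < k := by
  simp only [extendTableau]
  constructor
  · intro h
    exact ⟨h.trans_le (h₂ i), by rw [if_pos h]; exact hT.1 i j h⟩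
  · rintro ⟨h, h'⟩
    by_contra hn
    rw [if_neg hn, if_pos h] at h'
    exact lt_irrefl _ h'

theorem extendTableau_shape_injective {L L₁ L₂ : ℕ → ℕ} {k : ℕ} {T₁ T₂ : ℕ → ℕ → ℕ}
    (h₁ : ∀ i, L₁ i ≤ L i) (h₂ : ∀ i, L₂ i ≤ L i) (hT₁ : T₁ ∈ tableauFunctions L₁ k)
    (hT₂ : T₂ ∈ tableauFunctions L₂ k)
    (h : extendTableau L L₁ k T₁ = extendTableau L L₂ k T₂) : L₁ = L₂ := by
  funext i
  refine eq_of_forall_lt_iff fun j => ?_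
  rw [extendTableau_lt_iff h₁ hT₁, extendTableau_lt_iff h₂ hT₂, h]

theorem extendTableau_injOn (L L' : ℕ → ℕ) (k : ℕ) :
    InjOn (extendTableau L L' k) (tableauFunctions L' k) := by
  intro T₁ h₁ T₂ h₂ h
  funext i j
  by_cases hj : j < L' i
  · simpa [extendTableau, hj] using congrFun (congrFun h i) j
  · rw [h₁.2.2.2 i j (not_lt.1 hj), h₂.2.2.2 i j (not_lt.1 hj)]

theorem le_tableau_entry {L : ℕ → ℕ} {k : ℕ} {T : ℕ → ℕ → ℕ} (hL : Antitone L)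
    (hT : T ∈ tableauFunctions L k) (i j : ℕ) (hj : j < L i) : i ≤ T i j := by
  induction i with
  | zero => exact Nat.zero_le _
  | succ i ih =>
    have := ih (hj.trans_le (hL i.le_succ))
    have := hT.2.2.1 i (i + 1) j i.lt_succ_self hj
    omega

/-- Cells with entry `k` end their rows, and column strictness allows at most one per column. Row
`k` disappears entirely since entries in row `i` are at least `i`. -/
theorem exists_extendTableau_eq {L : ℕ → ℕ} {k : ℕ} {T : ℕ → ℕ → ℕ} (hL : Antitone L)
    (hT : T ∈ tableauFunctions L (k + 1)) :
    ∃ L' : ℕ → ℕ, (∀ i, L (i + 1) ≤ L' i) ∧ (∀ i, L' i ≤ L i) ∧ L' k = 0 ∧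
      ∃ T' ∈ tableauFunctions L' k, extendTableau L L' k T' = T := by
  obtain ⟨hb, hr, hc, hz⟩ := id hT
  -- The least such `j` is the new length of row `i`.
  have hex : ∀ i, ∃ j, L i ≤ j ∨ k ≤ T i j := fun i => ⟨L i, Or.inl le_rfl⟩
  have hlt : ∀ i j, j < Nat.find (hex i) ↔ j < L i ∧ T i j < k := by
    intro i j
    rw [Nat.lt_find_iff]
    constructor
    · intro h
      simpa using h j le_rfl
    · rintro ⟨h, h'⟩ j' hj'
      rcases hj'.eq_or_lt with rfl | hj'
      · simpa using ⟨h, h'⟩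
      · simpa using ⟨hj'.trans h, (hr i j' j hj' h).trans_lt h'⟩
  refine ⟨fun i => Nat.find (hex i), fun i => ?_, fun i => Nat.find_min' _ (Or.inl le_rfl), ?_,
    fun i j => if j < Nat.find (hex i) then T i j else 0, ⟨?_, ?_, ?_, ?_⟩, ?_⟩
  · refine le_of_forall_lt fun j hj => (hlt i j).2 ⟨hj.trans_le (hL i.le_succ), ?_⟩
    have := hc i (i + 1) j i.lt_succ_self hj
    have := hb (i + 1) j hj
    omega
  · by_contra h
    obtain ⟨h0, h'⟩ := (hlt k 0).1 (Nat.pos_of_ne_zero h)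
    exact absurd (le_tableau_entry hL hT k 0 h0) (not_le.2 h')
  · intro i j hj
    simp only [if_pos hj]
    exact ((hlt i j).1 hj).2
  · intro i j₁ j₂ hj h
    simp only [if_pos h, if_pos (hj.trans h)]
    exact hr i j₁ j₂ hj ((hlt i j₂).1 h).1
  · intro i₁ i₂ j hi hj
    obtain ⟨h, h'⟩ := (hlt i₂ j).1 hj
    have hcc := hc i₁ i₂ j hi h
    have : j < Nat.find (hex i₁) := (hlt i₁ j).2 ⟨h.trans_le (hL hi.le), hcc.trans h'⟩
    simp only [if_pos hj, if_pos this]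
    exact hcc
  · intro i j hj
    simp only [if_neg (not_lt.2 hj)]
  · funext i j
    simp only [extendTableau]
    by_cases h : j < Nat.find (hex i)
    · simp only [if_pos h]
    · simp only [if_neg h]
      split_ifs with h'
      · have h₁ := hb i j h'
        have h₂ : ¬ T i j < k := fun h'' => h ((hlt i j).2 ⟨h', h''⟩)
        omega
      · exact (hz i j (not_lt.1 h')).symm

/-- The product of the variables `U` over the cells in the first `N` rows of a tableau. -/
def tableauMonomial {R : Type*} [CommRing R] (U : ℕ → R) (N : ℕ) (L : ℕ → ℕ) (T : ℕ → ℕ → ℕ) : R :=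
  ∏ i ∈ Finset.range N, ∏ j ∈ Finset.range (L i), U (T i j)

theorem tableauMonomial_extendTableau {R : Type*} [CommRing R] (U : ℕ → R) {L L' : ℕ → ℕ} {k : ℕ}
    (h₂ : ∀ i, L' i ≤ L i) (hk : L' k = 0) (T : ℕ → ℕ → ℕ) :
    tableauMonomial U (k + 1) L (extendTableau L L' k T) =
      U k ^ (∑ i ∈ Finset.range (k + 1), (L i - L' i)) * tableauMonomial U k L' T := by
  have hrow : ∀ i, ∏ j ∈ Finset.range (L i), U (extendTableau L L' k T i j) =
      U k ^ (L i - L' i) * ∏ j ∈ Finset.range (L' i), U (T i j) := by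
    intro i
    rw [← Finset.prod_range_mul_prod_Ico _ (h₂ i), mul_comm]
    congr 1
    · rw [Finset.prod_congr rfl (g := fun _ => U k), Finset.prod_const, Nat.card_Ico]
      intro j hj
      rw [Finset.mem_Ico] at hj
      simp [extendTableau, not_lt.2 hj.1, hj.2]
    · refine Finset.prod_congr rfl fun j hj => ?_
      simp [extendTableau, Finset.mem_range.1 hj]
  simp only [tableauMonomial, hrow, Finset.prod_mul_distrib, Finset.prod_pow_eq_pow_sum]
  rw [Finset.prod_range_succ (fun i => ∏ j ∈ Finset.range (L' i), U (T i j)), hk]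
  simp

/-- Row lengths of the shape attached to a strictly increasing tuple. -/
def rowLength {n : ℕ} (l : Fin n → ℕ) (i : ℕ) : ℕ :=
  if h : i < n then l ⟨n - 1 - i, by omega⟩ - (n - 1 - i) else 0

theorem rowLength_antitone {n : ℕ} {l : Fin n → ℕ} (hl : StrictMono l) :
    Antitone (rowLength l) := by
  refine antitone_nat_of_succ_le fun i => ?_
  simp only [rowLength]
  split_ifs with h h'
  · have : l ⟨n - 1 - (i + 1), by omega⟩ < l ⟨n - 1 - i, by omega⟩ :=
      hl (by rw [Fin.lt_def]; simp only; omega)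
    omega
  · omega
  · exact Nat.zero_le _
  · exact le_rfl

theorem StrictMono.val_le_apply {n : ℕ} {l : Fin n → ℕ} (hl : StrictMono l) (i : Fin n) :
    (i : ℕ) ≤ l i := by
  obtain ⟨i, hi⟩ := i
  induction i with
  | zero => exact Nat.zero_le _
  | succ i ih =>
    have := ih (by omega)
    have : l ⟨i, by omega⟩ < l ⟨i + 1, hi⟩ := hl (by simp)
    simp only at *
    omega

/-- The tuples interlacing a given one. -/
def interlacing {n : ℕ} (l : Fin (n + 1) → ℕ) : Finset (Fin n → ℕ) :=
  Fintype.piFinset fun k : Fin n => Finset.Ico (l k.castSucc) (l k.succ)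

theorem mem_interlacing {n : ℕ} {l : Fin (n + 1) → ℕ} {μ : Fin n → ℕ} :
    μ ∈ interlacing l ↔ ∀ k : Fin n, l k.castSucc ≤ μ k ∧ μ k < l k.succ := by
  simp [interlacing, Fintype.mem_piFinset]

theorem strictMono_of_mem_interlacing {n : ℕ} {l : Fin (n + 1) → ℕ} (hl : StrictMono l)
    {μ : Fin n → ℕ} (hμ : μ ∈ interlacing l) : StrictMono μ := by
  rw [mem_interlacing] at hμ
  intro i j hij
  refine (hμ i).2.trans_le (le_trans (hl.monotone ?_) (hμ j).1)
  rw [Fin.le_def]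
  simpa using hij

/-- Strict monotonicity gives `i ≤ l i`, so the truncated subtraction loses nothing. -/
theorem rowLength_injOn {n : ℕ} :
    InjOn (rowLength : (Fin n → ℕ) → ℕ → ℕ) {l | StrictMono l} := by
  intro l hl l' hl' h
  funext i
  have h' := congrFun h (n - 1 - i)
  have hi := i.isLt
  have e : (⟨n - 1 - (n - 1 - i), by omega⟩ : Fin n) = i := Fin.ext (by simp only; omega)
  simp only [rowLength, show n - 1 - (i : ℕ) < n by omega, dif_pos, e] at h'
  have h₁ := StrictMono.val_le_apply hl i
  have h₂ := StrictMono.val_le_apply hl' i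
  omega

/-- The staircase offset of `l k.succ` exceeds that of `μ k` by one, which turns the strict upper
bound into a weak one. -/
theorem rowLength_interlacing {n : ℕ} {l : Fin (n + 1) → ℕ} {μ : Fin n → ℕ}
    (hμ : μ ∈ interlacing l) (i : ℕ) :
    rowLength l (i + 1) ≤ rowLength μ i ∧ rowLength μ i ≤ rowLength l i := by
  rw [mem_interlacing] at hμ
  simp only [rowLength]
  by_cases h : i < n
  · have hk := hμ ⟨n - 1 - i, by omega⟩
    rw [dif_pos (by omega), dif_pos h, dif_pos (by omega)]
    have e₁ : (⟨n + 1 - 1 - (i + 1), by omega⟩ : Fin (n + 1)) =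
      (⟨n - 1 - i, by omega⟩ : Fin n).castSucc := Fin.ext (by simp only [Fin.val_castSucc]; omega)
    have e₂ : (⟨n + 1 - 1 - i, by omega⟩ : Fin (n + 1)) =
      (⟨n - 1 - i, by omega⟩ : Fin n).succ := Fin.ext (by simp only [Fin.val_succ]; omega)
    rw [e₁, e₂]
    omega
  · rw [dif_neg (by omega), dif_neg h]
    exact ⟨le_rfl, Nat.zero_le _⟩

theorem exists_interlacing_of_rowLength {n : ℕ} {l : Fin (n + 1) → ℕ} (hl : StrictMono l)
    {L' : ℕ → ℕ} (h₁ : ∀ i, rowLength l (i + 1) ≤ L' i) (h₂ : ∀ i, L' i ≤ rowLength l i)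
    (hn : L' n = 0) : ∃ μ ∈ interlacing l, rowLength μ = L' := by
  -- Reverse the rows and add the staircase back.
  refine ⟨fun k => L' (n - 1 - k) + k, mem_interlacing.2 fun k => ?_, ?_⟩
  · have hk := k.isLt
    have h₁ := h₁ (n - 1 - k)
    have h₂ := h₂ (n - 1 - k)
    simp only [rowLength] at h₁ h₂
    rw [dif_pos (by omega)] at h₁ h₂
    have e₁ : (⟨n + 1 - 1 - (n - 1 - k + 1), by omega⟩ : Fin (n + 1)) = k.castSucc :=
      Fin.ext (by simp only [Fin.val_castSucc]; omega)
    have e₂ : (⟨n + 1 - 1 - (n - 1 - k), by omega⟩ : Fin (n + 1)) = k.succ :=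
      Fin.ext (by simp only [Fin.val_succ]; omega)
    rw [e₁] at h₁
    rw [e₂] at h₂
    have h₃ := StrictMono.val_le_apply hl k.succ
    simp only [Fin.val_succ] at h₃
    omega
  · funext i
    simp only [rowLength]
    split_ifs with h
    · rw [Nat.add_sub_cancel]
      congr 1
      omega
    · rcases (not_lt.1 h).eq_or_lt with rfl | h
      · exact hn.symm
      · have := h₂ i
        simp only [rowLength, dif_neg (show ¬ i < n + 1 by omega)] at this
        omega

theorem sum_rowLength_sub {n : ℕ} {l : Fin (n + 1) → ℕ} (hl : StrictMono l) {μ : Fin n → ℕ}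
    (hμ : μ ∈ interlacing l) :
    ∑ i ∈ Finset.range (n + 1), (rowLength l i - rowLength μ i) =
      l 0 + ∑ k : Fin n, (l k.succ - 1 - μ k) := by
  rw [Finset.sum_range_succ, add_comm]
  congr 1
  · simp [rowLength]
  -- Rows run from the largest index down, so the sum is reversed; the bottom row was split off as
  -- `l 0`.
  · rw [Finset.sum_range, ← Equiv.sum_comp Fin.revPerm]
    refine Finset.sum_congr rfl fun k _ => ?_
    have hk := k.isLt
    simp only [rowLength, Fin.revPerm_apply, Fin.val_rev]
    rw [dif_pos (by omega), dif_pos (by omega)]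
    have e₁ : (⟨n + 1 - 1 - (n - (k + 1)), by omega⟩ : Fin (n + 1)) = k.succ :=
      Fin.ext (by simp only [Fin.val_succ]; omega)
    have e₂ : (⟨n - 1 - (n - (k + 1)), by omega⟩ : Fin n) = k :=
      Fin.ext (by simp only; omega)
    rw [e₁, e₂]
    have h₃ := StrictMono.val_le_apply (strictMono_of_mem_interlacing hl hμ) k
    have h₄ := ((mem_interlacing.1 hμ) k).2
    omega

theorem tableauFunctions_succ {n : ℕ} {l : Fin (n + 1) → ℕ} (hl : StrictMono l) :
    tableauFunctions (rowLength l) (n + 1) = ⋃ μ ∈ (interlacing l : Set (Fin n → ℕ)),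
      extendTableau (rowLength l) (rowLength μ) n '' tableauFunctions (rowLength μ) n := by
  ext T
  simp only [mem_iUnion, Finset.mem_coe, exists_prop]
  constructor
  · intro hT
    obtain ⟨L', h₁, h₂, hn, T', hT', rfl⟩ := exists_extendTableau_eq (rowLength_antitone hl) hT
    obtain ⟨μ, hμ, rfl⟩ := exists_interlacing_of_rowLength hl h₁ h₂ hn
    exact ⟨μ, hμ, T', hT', rfl⟩
  · rintro ⟨μ, hμ, T', hT', rfl⟩
    exact extendTableau_mem (rowLength_antitone hl) (fun i => (rowLength_interlacing hμ i).1)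
      (fun i => (rowLength_interlacing hμ i).2) hT'

theorem tableauFunctions_finite {n : ℕ} (l : Fin n → ℕ) (hl : StrictMono l) :
    (tableauFunctions (rowLength l) n).Finite := by
  induction n with
  | zero =>
    refine (Set.finite_singleton (fun _ _ => 0)).subset fun T hT => ?_
    rw [Set.mem_singleton_iff]
    funext i j
    exact hT.2.2.2 i j (by simp [rowLength])
  | succ n ih =>
    rw [tableauFunctions_succ hl]
    exact Set.Finite.biUnion (interlacing l).finite_toSet fun μ hμ =>
      (ih μ (strictMono_of_mem_interlacing hl hμ)).image _

/-- Branching rule for the generating function of tableaux. -/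
theorem finsum_tableauMonomial_succ {R : Type*} [CommRing R] (U : ℕ → R) {n : ℕ}
    {l : Fin (n + 1) → ℕ} (hl : StrictMono l) :
    ∑ᶠ T ∈ tableauFunctions (rowLength l) (n + 1), tableauMonomial U (n + 1) (rowLength l) T =
      ∑ μ ∈ interlacing l, U n ^ (l 0 + ∑ k : Fin n, (l k.succ - 1 - μ k)) *
        ∑ᶠ T ∈ tableauFunctions (rowLength μ) n, tableauMonomial U n (rowLength μ) T := by
  have hfin : ∀ μ ∈ interlacing l, (tableauFunctions (rowLength μ) n).Finite := fun μ hμ =>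
    tableauFunctions_finite μ (strictMono_of_mem_interlacing hl hμ)
  rw [tableauFunctions_succ hl, finsum_mem_biUnion ?_ (interlacing l).finite_toSet
    fun μ hμ => (hfin μ hμ).image _, finsum_mem_coe_finset]
  · refine Finset.sum_congr rfl fun μ hμ => ?_
    rw [finsum_mem_image (extendTableau_injOn _ _ _), mul_finsum_mem' _ _ (hfin μ hμ)]
    refine finsum_mem_congr rfl fun T _ => ?_
    rw [tableauMonomial_extendTableau U (fun i => (rowLength_interlacing hμ i).2)
      (by simp [rowLength]), sum_rowLength_sub hl hμ]
  · intro μ hμ ν hν hne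
    refine Set.disjoint_left.2 ?_
    rintro _ ⟨T, hT, rfl⟩ ⟨T', hT', h⟩
    exact hne (rowLength_injOn (strictMono_of_mem_interlacing hl hμ)
      (strictMono_of_mem_interlacing hl hν) (extendTableau_shape_injective
        (fun i => (rowLength_interlacing hμ i).2) (fun i => (rowLength_interlacing hν i).2)
        hT hT' h.symm))

/-- The bialternant formula, for tableaux given as functions. -/
theorem det_pow_eq_finsum_tableauMonomial {R : Type*} [CommRing R] (U : ℕ → R) {n : ℕ}
    (l : Fin n → ℕ) (hl : StrictMono l) :
    Matrix.det (Matrix.of fun i j : Fin n => U i ^ l j) =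
      (∏ k ∈ Finset.range n, ∏ j ∈ Finset.range k, (U k - U j)) *
        ∑ᶠ T ∈ tableauFunctions (rowLength l) n, tableauMonomial U n (rowLength l) T := by
  induction n with
  | zero =>
    have : tableauFunctions (rowLength l) 0 = {fun _ _ => 0} := by
      ext T
      rw [Set.mem_singleton_iff]
      constructor
      · intro hT
        funext i j
        exact hT.2.2.2 i j (by simp [rowLength])
      · rintro rfl
        simp [tableauFunctions, rowLength]
    rw [this, finsum_mem_singleton]
    simp [tableauMonomial]
  | succ n ih =>
    -- Both sides branch over the same interlacing tuples with the same power of `U n`; the extra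
    -- factor completes the Vandermonde product.
    rw [det_pow_succ U l hl, finsum_tableauMonomial_succ U hl, Finset.prod_range_succ,
      Finset.mul_sum, Finset.mul_sum]
    refine Finset.sum_congr rfl fun μ hμ => ?_
    rw [ih μ (strictMono_of_mem_interlacing hl hμ)]
    ring

end Tableaux

/-! ### The bialternant formula for Schur polynomials -/

section Schur

variable {R : Type*} [CommRing R]

theorem mem_schurShape {n : ℕ} {l : Fin n → ℕ} (hl : StrictMono l) (i j : ℕ) :
    (i, j) ∈ schurShape l hl ↔ j < rowLength l i := by
  rw [← YoungDiagram.mem_cells]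
  simp only [schurShape, Finset.mem_biUnion, Finset.mem_univ, true_and, Finset.mem_image,
    Finset.mem_range, Prod.mk.injEq, rowLength, Fin.val_rev]
  constructor
  · rintro ⟨r, c, hc, rfl, rfl⟩
    rw [dif_pos r.isLt]
    have e : (⟨n - 1 - r, by omega⟩ : Fin n) = r.rev := Fin.ext (by simp only [Fin.val_rev]; omega)
    rw [e]
    omega
  · intro h
    split_ifs at h with hi
    · refine ⟨⟨i, hi⟩, j, ?_, rfl, rfl⟩
      have e : (⟨n - 1 - i, by omega⟩ : Fin n) = Fin.rev ⟨i, hi⟩ :=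
        Fin.ext (by simp only [Fin.val_rev]; omega)
      rw [e] at h
      simp only
      omega
    · exact absurd h (Nat.not_lt_zero _)

/-- Bounded tableaux of shape `schurShape l` are the column-strict functions. -/
def boundedTableauEquiv {n : ℕ} (l : Fin n → ℕ) (hl : StrictMono l) (k : ℕ) :
    BoundedTableau (schurShape l hl) k ≃ tableauFunctions (rowLength l) k where
  toFun T := ⟨fun i j => T.1 i j, fun i j h => T.2 i j ((mem_schurShape hl i j).2 h),
    fun i _ j₂ h h' => T.1.row_weak h ((mem_schurShape hl i j₂).2 h'),
    fun _ i₂ j h h' => T.1.col_strict h ((mem_schurShape hl i₂ j).2 h'),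
    fun i j h => T.1.zeros fun h' => not_lt.2 h ((mem_schurShape hl i j).1 h')⟩
  invFun T := ⟨⟨T.1, fun h h' => T.2.2.1 _ _ _ h ((mem_schurShape hl _ _).1 h'),
    fun h h' => T.2.2.2.1 _ _ _ h ((mem_schurShape hl _ _).1 h'),
    fun h => T.2.2.2.2 _ _ (not_lt.1 fun h' => h ((mem_schurShape hl _ _).2 h'))⟩,
    fun i j h => T.2.1 i j ((mem_schurShape hl i j).1 h)⟩
  left_inv _ := rfl
  right_inv _ := rfl

/-- The same product over cells, grouped once by entry and once by row. -/
theorem weight_eq_tableauMonomial (U : ℕ → R) {n : ℕ} {l : Fin n → ℕ} (hl : StrictMono l)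
    (T : BoundedTableau (schurShape l hl) n) :
    T.weight (fun i : Fin n => U i) =
      tableauMonomial U n (rowLength l) (boundedTableauEquiv l hl n T).1 := by
  rw [tableauMonomial, ← Finset.prod_finset_product (schurShape l hl).cells (Finset.range n)
    (fun i => Finset.range (rowLength l i)) _
    (f := fun c => U ((boundedTableauEquiv l hl n T).1 c.1 c.2))]
  · rw [BoundedTableau.weight, ← Finset.prod_fiberwise_of_maps_to (t := Finset.range n)
      (g := fun c : ℕ × ℕ => T.1 c.1 c.2)
      fun c hc => Finset.mem_range.2 (T.2 c.1 c.2 ((YoungDiagram.mem_cells _).1 hc)),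
      Finset.prod_range]
    refine Finset.prod_congr rfl fun j _ => ?_
    rw [← Finset.prod_const]
    refine Finset.prod_congr rfl fun c hc => ?_
    rw [← (Finset.mem_filter.1 hc).2]
    rfl
  · rintro ⟨i, j⟩
    simp only [YoungDiagram.mem_cells, mem_schurShape, Finset.mem_range]
    refine ⟨fun h => ⟨?_, h⟩, fun h => h.2⟩
    by_contra hi
    simp [rowLength, hi] at h

theorem vandermondeProd_eq_prod_range (U : ℕ → R) (n : ℕ) :
    vandermondeProd (fun i : Fin n => U i) =
      ∏ k ∈ Finset.range n, ∏ j ∈ Finset.range k, (U k - U j) := by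
  rw [vandermondeProd, Finset.prod_comm' (t' := Finset.univ) (s' := fun k => Finset.Iio k)
    (by simp), Finset.prod_range]
  refine Finset.prod_congr rfl fun k _ => ?_
  rw [← Nat.Iio_eq_range, ← Fin.map_valEmbedding_Iio, Finset.prod_map]
  rfl

/-- The bialternant formula: an alternant is the Vandermonde product times a Schur polynomial. -/
theorem det_pow_eq_vandermondeProd_mul_schurPoly {n : ℕ} (u : Fin n → R) {l : Fin n → ℕ}
    (hl : StrictMono l) :
    Matrix.det (Matrix.of fun i j => u i ^ l j) = vandermondeProd u * schurPoly l u := by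
  obtain ⟨U, rfl⟩ : ∃ U : ℕ → R, u = fun i : Fin n => U i :=
    -- The value past `n` is arbitrary.
    ⟨fun j => if h : j < n then u ⟨j, h⟩ else 1, by funext i; simp⟩
  rw [det_pow_eq_finsum_tableauMonomial U l hl, vandermondeProd_eq_prod_range, schurPoly,
    dif_pos hl, ← finsum_set_coe_eq_finsum_mem,
    ← finsum_comp_equiv (boundedTableauEquiv l hl n)]
  simp only [weight_eq_tableauMonomial]

end Schur

/-! ### A formal Cauchy–Binet expansion -/

section CauchyBinet

variable {R : Type*} [CommRing R]

theorem PowerSeries.coeff_prod_piAntidiag {n : ℕ} (f : Fin n → PowerSeries R) (M : ℕ) :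
    PowerSeries.coeff M (∏ i, f i) =
      ∑ l ∈ Finset.piAntidiag Finset.univ M, ∏ i, PowerSeries.coeff (l i) (f i) := by
  rw [PowerSeries.coeff_prod]
  refine Finset.sum_equiv Finsupp.equivFunOnFinite (fun l => ?_) fun l _ => rfl
  simp [Finset.mem_finsuppAntidiag, Finset.mem_piAntidiag]

/-- Sorting writes an injective tuple uniquely as a strictly increasing one composed with a
permutation. -/
theorem sum_injective_eq_sum_strictMono {n : ℕ} (M : ℕ) (F : (Fin n → ℕ) → R) :
    ∑ l ∈ Finset.piAntidiag Finset.univ M with Function.Injective l, F l =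
      ∑ l ∈ Finset.piAntidiag Finset.univ M with StrictMono l,
        ∑ σ : Equiv.Perm (Fin n), F (l ∘ σ) := by
  rw [← Finset.sum_product']
  symm
  refine Finset.sum_nbij (fun p => p.1 ∘ p.2) ?_ ?_ ?_ fun _ _ => rfl
  · rintro ⟨l, σ⟩ h
    simp only [Finset.mem_product, Finset.mem_filter, Finset.mem_piAntidiag, Finset.mem_univ,
      and_true, implies_true] at h ⊢
    refine ⟨?_, h.2.injective.comp σ.injective⟩
    rw [← h.1]
    exact Equiv.sum_comp σ l
  · rintro ⟨l, σ⟩ h ⟨l', σ'⟩ h' he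
    simp only [Finset.coe_product, Set.mem_prod, Finset.mem_coe, Finset.mem_filter] at h h'
    simp only at he
    have hr : Set.range l = Set.range l' := by
      rw [← σ.surjective.range_comp l, he, σ'.surjective.range_comp]
    have hll : l = l' := (StrictMono.range_inj h.1.2 h'.1.2).1 hr
    subst hll
    have : σ = σ' := Equiv.ext fun i => h.1.2.injective (congrFun he i)
    rw [this]
  · intro l hl
    simp only [Finset.coe_filter, Set.mem_ofPred_eq, Finset.mem_piAntidiag] at hl
    refine ⟨(l ∘ Tuple.sort l, (Tuple.sort l)⁻¹), ?_, ?_⟩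
    · simp only [Finset.coe_product, Set.mem_prod, Finset.mem_coe, Finset.mem_filter,
        Finset.mem_piAntidiag, Finset.mem_univ, and_true, implies_true]
      refine ⟨?_, (Tuple.monotone_sort l).strictMono_of_injective
        (hl.2.comp (Tuple.sort l).injective)⟩
      rw [← hl.1.1]
      exact Equiv.sum_comp (Tuple.sort l) l
    · funext i
      simp

/-- The coefficients of `det (F (u_i v_j X))` for a power series `F`. -/
theorem coeff_det_mk_pow {n : ℕ} (c : ℕ → R) (u v : Fin n → R) (M : ℕ) :
    PowerSeries.coeff M (Matrix.det (Matrix.of fun i j =>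
      PowerSeries.mk fun k => (u i * v j) ^ k * c k)) =
      ∑ l ∈ Finset.piAntidiag Finset.univ M with StrictMono l, (∏ k, c (l k)) *
        (Matrix.det (Matrix.of fun i j => u i ^ l j) *
          Matrix.det (Matrix.of fun i j => v i ^ l j)) := by
  -- For fixed exponents `l`, the powers of `v` do not depend on the permutation, so the Leibniz sum
  -- is already an alternant in `u`. The alternant in `v` arises from summing over rearrangements of
  -- `l`.
  have hexp : PowerSeries.coeff M (Matrix.det (Matrix.of fun i j =>
      PowerSeries.mk fun k => (u i * v j) ^ k * c k)) =
      ∑ l ∈ Finset.piAntidiag Finset.univ M, (∏ k, c (l k)) * (∏ k, v k ^ l k) *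
        Matrix.det (Matrix.of fun i j => u i ^ l j) := by
    have hsign : ∀ (σ : Equiv.Perm (Fin n)) (P : PowerSeries R), PowerSeries.coeff M
        (((Equiv.Perm.sign σ : ℤ) : PowerSeries R) * P) =
          ((Equiv.Perm.sign σ : ℤ) : R) * PowerSeries.coeff M P := by
      intro σ P
      rw [← zsmul_eq_mul, map_zsmul, zsmul_eq_mul]
    simp only [Matrix.det_apply', Matrix.of_apply, map_sum, hsign,
      PowerSeries.coeff_prod_piAntidiag, PowerSeries.coeff_mk, Finset.mul_sum]
    rw [Finset.sum_comm]
    refine Finset.sum_congr rfl fun l _ => Finset.sum_congr rfl fun σ _ => ?_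
    simp only [mul_pow, Finset.prod_mul_distrib]
    ring
  rw [hexp, ← Finset.sum_filter_add_sum_filter_not _ fun l => Function.Injective l]
  rw [Finset.sum_eq_zero (s := Finset.filter (fun l => ¬ Function.Injective l) _), add_zero,
    sum_injective_eq_sum_strictMono]
  · refine Finset.sum_congr rfl fun l _ => ?_
    rw [Matrix.det_apply' (Matrix.of fun i j => v i ^ l j), Finset.mul_sum, Finset.mul_sum,
      ← Equiv.sum_comp (Equiv.inv (Equiv.Perm (Fin n)))]
    refine Finset.sum_congr rfl fun σ _ => ?_
    have hdet : Matrix.det (Matrix.of fun i j => u i ^ (l ∘ ⇑σ⁻¹) j) =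
        (Equiv.Perm.sign σ : ℤ) * Matrix.det (Matrix.of fun i j => u i ^ l j) := by
      have := Matrix.det_permute' σ⁻¹ (Matrix.of fun i j => u i ^ l j)
      rw [Equiv.Perm.sign_inv] at this
      exact this
    have hv : ∏ k, v k ^ (l ∘ ⇑σ⁻¹) k = ∏ k, v (σ k) ^ l k := by
      rw [← Equiv.prod_comp σ]
      simp
    have hc : ∏ k, c ((l ∘ ⇑σ⁻¹) k) = ∏ k, c (l k) := Equiv.prod_comp σ⁻¹ fun k => c (l k)
    simp only [Equiv.inv_apply, Matrix.of_apply]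
    rw [hdet, hv, hc]
    ring
  -- A repeated exponent gives two equal columns.
  · intro l hl
    obtain ⟨i, j, hij, hne⟩ : ∃ i j, l i = l j ∧ i ≠ j := by
      simpa [Function.Injective] using (Finset.mem_filter.1 hl).2
    rw [Matrix.det_zero_of_column_eq hne fun k => by simp [hij], mul_zero]

end CauchyBinet

/-! ### Jets and higher derivatives at a point -/

section Jets

open scoped PowerSeries

/-- The coefficients of the power series `P y` behave like the divided derivatives at `y` of an
`M` times differentiable function. -/
def IsJetWithinAt (M : ℕ) (P : ℝ → ℝ⟦X⟧) (s : Set ℝ) (x : ℝ) : Prop :=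
  (∀ k : ℕ, k + 1 < M → ∀ᶠ y in 𝓝[s] x, HasDerivWithinAt (fun z => PowerSeries.coeff k (P z))
    (PowerSeries.coeff k (PowerSeries.derivative ℝ (P y))) s y) ∧
  (∀ k : ℕ, k + 1 = M → HasDerivWithinAt (fun z => PowerSeries.coeff k (P z))
    (PowerSeries.coeff k (PowerSeries.derivative ℝ (P x))) s x)

namespace IsJetWithinAt

variable {M : ℕ} {P Q : ℝ → ℝ⟦X⟧} {s : Set ℝ} {x : ℝ}

theorem eventually (h : IsJetWithinAt M P s x) {k : ℕ} (hk : k + 1 < M) :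
    ∀ᶠ y in 𝓝[s] x, ∀ i ≤ k, HasDerivWithinAt (fun z => PowerSeries.coeff i (P z))
      (PowerSeries.coeff i (PowerSeries.derivative ℝ (P y))) s y := by
  have := (Finset.range (k + 1)).eventually_all.2 fun i hi =>
    h.1 i (by have := Finset.mem_range.1 hi; omega)
  filter_upwards [this] with y hy i hi
  exact hy i (Finset.mem_range.2 (by omega))

theorem hasDerivWithinAt (h : IsJetWithinAt M P s x) (hx : x ∈ s) {k : ℕ} (hk : k < M) :
    HasDerivWithinAt (fun z => PowerSeries.coeff k (P z))
      (PowerSeries.coeff k (PowerSeries.derivative ℝ (P x))) s x := by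
  rcases (Nat.succ_le_of_lt hk).lt_or_eq with hk | hk
  · exact (h.1 k hk).self_of_nhdsWithin hx
  · exact h.2 k hk

theorem const (p : ℝ) : IsJetWithinAt M (fun _ => PowerSeries.C p) s x := by
  constructor <;> intro k _
  · refine Eventually.of_forall fun y => ?_
    rw [PowerSeries.derivative_C, map_zero]
    exact hasDerivWithinAt_const _ _ _
  · rw [PowerSeries.derivative_C, map_zero]
    exact hasDerivWithinAt_const _ _ _

theorem add (hP : IsJetWithinAt M P s x) (hQ : IsJetWithinAt M Q s x) :
    IsJetWithinAt M (fun y => P y + Q y) s x := by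
  constructor <;> intro k hk
  · filter_upwards [hP.1 k hk, hQ.1 k hk] with y h₁ h₂
    simp only [map_add]
    exact h₁.add h₂
  · simp only [map_add]
    exact (hP.2 k hk).add (hQ.2 k hk)

theorem sum {ι : Type*} {t : Finset ι} {P : ι → ℝ → ℝ⟦X⟧}
    (h : ∀ i ∈ t, IsJetWithinAt M (P i) s x) : IsJetWithinAt M (fun y => ∑ i ∈ t, P i y) s x := by
  classical
  induction t using Finset.induction_on with
  | empty => simpa using const (M := M) (s := s) (x := x) 0
  | insert a t ha ih =>
    simp only [Finset.sum_insert ha]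
    exact (h a (Finset.mem_insert_self a t)).add
      (ih fun i hi => h i (Finset.mem_insert_of_mem hi))

/-- This is the Leibniz rule on both sides; only coefficients of index at most `k` need to be
differentiated. -/
theorem hasDerivWithinAt_coeff_mul {k : ℕ} {y : ℝ}
    (hP : ∀ i ≤ k, HasDerivWithinAt (fun z => PowerSeries.coeff i (P z))
      (PowerSeries.coeff i (PowerSeries.derivative ℝ (P y))) s y)
    (hQ : ∀ i ≤ k, HasDerivWithinAt (fun z => PowerSeries.coeff i (Q z))
      (PowerSeries.coeff i (PowerSeries.derivative ℝ (Q y))) s y) :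
    HasDerivWithinAt (fun z => PowerSeries.coeff k (P z * Q z))
      (PowerSeries.coeff k (PowerSeries.derivative ℝ (P y * Q y))) s y := by
  rw [Derivation.leibniz, map_add, smul_eq_mul, smul_eq_mul, mul_comm (Q y), add_comm]
  simp only [PowerSeries.coeff_mul, ← Finset.sum_add_distrib]
  refine HasDerivWithinAt.fun_sum fun p hp => ?_
  rw [Finset.HasAntidiagonal.mem_antidiagonal] at hp
  exact (hP p.1 (by omega)).mul (hQ p.2 (by omega))

theorem mul (hx : x ∈ s) (hP : IsJetWithinAt M P s x) (hQ : IsJetWithinAt M Q s x) :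
    IsJetWithinAt M (fun y => P y * Q y) s x := by
  constructor <;> intro k hk
  · filter_upwards [hP.eventually hk, hQ.eventually hk] with y h₁ h₂
    exact hasDerivWithinAt_coeff_mul h₁ h₂
  · exact hasDerivWithinAt_coeff_mul (fun i _ => hP.hasDerivWithinAt hx (by omega))
      fun i _ => hQ.hasDerivWithinAt hx (by omega)

theorem prod (hx : x ∈ s) {ι : Type*} {t : Finset ι} {P : ι → ℝ → ℝ⟦X⟧}
    (h : ∀ i ∈ t, IsJetWithinAt M (P i) s x) : IsJetWithinAt M (fun y => ∏ i ∈ t, P i y) s x := by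
  classical
  induction t using Finset.induction_on with
  | empty => simpa using const (M := M) (s := s) (x := x) 1
  | insert a t ha ih =>
    simp only [Finset.prod_insert ha]
    exact (h a (Finset.mem_insert_self a t)).mul hx
      (ih fun i hi => h i (Finset.mem_insert_of_mem hi))

theorem det (hx : x ∈ s) {n : ℕ} {P : Fin n → Fin n → ℝ → ℝ⟦X⟧}
    (h : ∀ i j, IsJetWithinAt M (P i j) s x) :
    IsJetWithinAt M (fun y => Matrix.det (Matrix.of fun i j => P i j y)) s x := by
  simp only [Matrix.det_apply', Matrix.of_apply]
  refine sum fun σ _ => mul hx ?_ (prod hx fun i _ => h _ _)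
  simpa using const (M := M) (s := s) (x := x) ((Equiv.Perm.sign σ : ℤ) : ℝ)

theorem eventually_iteratedDerivWithin_eq (h : IsJetWithinAt M P s x) (hs : UniqueDiffOn ℝ s)
    {k : ℕ} (hk : k < M) :
    ∀ᶠ y in 𝓝[s] x, iteratedDerivWithin k (fun z => PowerSeries.coeff 0 (P z)) s y =
      k.factorial * PowerSeries.coeff k (P y) := by
  induction k with
  | zero => simp
  | succ k ih =>
    filter_upwards [eventually_eventually_nhdsWithin.2 (ih (by omega)), h.1 k hk,
      self_mem_nhdsWithin] with y h₁ h₂ hy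
    rw [iteratedDerivWithin_succ, Filter.EventuallyEq.derivWithin_eq_of_mem h₁ hy,
      (h₂.const_mul (k.factorial : ℝ)).derivWithin (hs y hy), PowerSeries.coeff_derivative,
      Nat.factorial_succ]
    push_cast
    ring

/-- The top order `k = M` is reached only at `x` itself, by differentiating once more the formula
valid near `x` at order `M - 1`. -/
theorem iteratedDerivWithin_eq (h : IsJetWithinAt M P s x) (hs : UniqueDiffOn ℝ s)
    (hx : x ∈ s) {k : ℕ} (hk : k ≤ M) :
    iteratedDerivWithin k (fun z => PowerSeries.coeff 0 (P z)) s x =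
      k.factorial * PowerSeries.coeff k (P x) := by
  cases k with
  | zero => simp
  | succ k =>
    rw [iteratedDerivWithin_succ,
      Filter.EventuallyEq.derivWithin_eq_of_mem (h.eventually_iteratedDerivWithin_eq hs hk) hx,
      ((h.hasDerivWithinAt hx hk).const_mul (k.factorial : ℝ)).derivWithin (hs x hx),
      PowerSeries.coeff_derivative, Nat.factorial_succ]
    push_cast
    ring

theorem timesDiffWithinAt (h : IsJetWithinAt M P s x) (hs : UniqueDiffOn ℝ s) (hx : x ∈ s) :
    TimesDiffWithinAt M (fun z => PowerSeries.coeff 0 (P z)) s x := by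
  constructor <;> intro k hk
  · filter_upwards [eventually_eventually_nhdsWithin.2
      (h.eventually_iteratedDerivWithin_eq hs (k := k) (by omega)), h.1 k hk,
      self_mem_nhdsWithin] with y h₁ h₂ hy
    exact ((h₂.const_mul (k.factorial : ℝ)).congr_of_eventuallyEq h₁
      (h₁.self_of_nhdsWithin hy)).differentiableWithinAt
  · have h₁ := h.eventually_iteratedDerivWithin_eq hs (k := k) (by omega)
    exact (((h.2 k hk).const_mul (k.factorial : ℝ)).congr_of_eventuallyEq h₁
      (h₁.self_of_nhdsWithin hx)).differentiableWithinAt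

end IsJetWithinAt

/-- The jet of `t ↦ f (a + t c)`. -/
theorem TimesDiffWithinAt.isJetWithinAt_comp_affine {M : ℕ} {f : ℝ → ℝ} {I s : Set ℝ} {a c : ℝ}
    (hf : TimesDiffWithinAt M f I a) (hmaps : MapsTo (fun t => a + t * c) s I) :
    IsJetWithinAt M (fun t => PowerSeries.mk fun k =>
      c ^ k * (iteratedDerivWithin k f I (a + t * c) / k.factorial)) s 0 := by
  have key : ∀ (k : ℕ) (t : ℝ),
      DifferentiableWithinAt ℝ (iteratedDerivWithin k f I) I (a + t * c) →
      HasDerivWithinAt (fun z => PowerSeries.coeff k (PowerSeries.mk fun k =>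
        c ^ k * (iteratedDerivWithin k f I (a + z * c) / k.factorial)))
        (PowerSeries.coeff k (PowerSeries.derivative ℝ (PowerSeries.mk fun k =>
          c ^ k * (iteratedDerivWithin k f I (a + t * c) / k.factorial)))) s t := by
    intro k t h
    simp only [PowerSeries.coeff_derivative, PowerSeries.coeff_mk]
    -- The chain rule supplies the factor that raises `c ^ k` to `c ^ (k + 1)`.
    have h₁ : HasDerivWithinAt (fun t : ℝ => a + t * c) (1 * c) s t :=
      ((hasDerivWithinAt_id t s).mul_const c).const_add a
    have h₂ := ((h.hasDerivWithinAt.comp t h₁ hmaps).div_const (k.factorial : ℝ)).const_mul (c ^ k)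
    refine h₂.congr_deriv ?_
    rw [iteratedDerivWithin_succ, Nat.factorial_succ]
    have := Nat.factorial_ne_zero k
    push_cast
    field_simp
    ring
  have htend : Tendsto (fun t : ℝ => a + t * c) (𝓝[s] 0) (𝓝[I] a) := by
    refine tendsto_nhdsWithin_iff.2 ⟨?_, eventually_mem_nhdsWithin.mono fun t ht => hmaps ht⟩
    have : Continuous fun t : ℝ => a + t * c := by fun_prop
    simpa using (this.tendsto 0).mono_left nhdsWithin_le_nhds
  constructor <;> intro k hk
  · exact (htend.eventually (hf.1 k hk)).mono fun t ht => key k t ht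
  · exact key k 0 (by simpa using hf.2 k hk)

end Jets

/-! ### Derivatives of the entrywise determinant -/

theorem entrywiseDet_eq_coeff_zero {n : ℕ} (f : ℝ → ℝ) (s : Set ℝ) (a : ℝ) (u v : Fin n → ℝ) :
    entrywiseDet f a u v = fun t => PowerSeries.coeff 0 (Matrix.det (Matrix.of fun i j =>
      PowerSeries.mk fun k => (u i * v j) ^ k *
        (iteratedDerivWithin k f s (a + t * (u i * v j)) / k.factorial))) := by
  funext t
  rw [PowerSeries.coeff_zero_eq_constantCoeff_apply, RingHom.map_det, entrywiseDet]
  congr 1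
  ext i j
  simp [Matrix.vecMulVec_apply, ← PowerSeries.coeff_zero_eq_constantCoeff_apply]

theorem StrictMono.choose_two_le_sum {n : ℕ} {l : Fin n → ℕ} (hl : StrictMono l) :
    n.choose 2 ≤ ∑ k, l k := by
  rw [Nat.choose_two_right, ← Finset.sum_range_id, Finset.sum_range]
  exact Finset.sum_le_sum fun i _ => StrictMono.val_le_apply hl i

theorem theoremB (n : ℕ) (hn : 1 ≤ n) (m : Fin n → ℕ) (hm : StrictMono m)
    (M : ℕ) (hM : M = ∑ k, m k)
    (I : Set ℝ) (hI : I.OrdConnected) (hI' : I.Nontrivial) (a : ℝ) (ha : a ∈ I)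
    (f : ℝ → ℝ) (hf : TimesDiffWithinAt M f I a) (u v : Fin n → ℝ)
    (δ : ℝ) (hδ : 0 < δ) (hdom : ∀ t ∈ Ico 0 δ, ∀ j k, a + t * (u j * v k) ∈ I) :
    TimesDiffWithinAt M (entrywiseDet f a u v) (Ico 0 δ) 0 ∧
    iteratedDerivWithin M (entrywiseDet f a u v) (Ico 0 δ) 0 =
      ∑ l ∈ partitionTuples n M,
        (Nat.multinomial Finset.univ l : ℝ) * (vandermondeProd u * vandermondeProd v) *
          (schurPoly l u * schurPoly l v) * ∏ k, iteratedDerivWithin (l k) f I a ∧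
    ∀ i < n.choose 2, iteratedDerivWithin i (entrywiseDet f a u v) (Ico 0 δ) 0 = 0 := by
  have hs : UniqueDiffOn ℝ (Ico 0 δ) := uniqueDiffOn_Ico 0 δ
  have h0 : (0 : ℝ) ∈ Ico 0 δ := ⟨le_rfl, hδ⟩
  have hjet := IsJetWithinAt.det h0 fun i j : Fin n =>
    hf.isJetWithinAt_comp_affine (c := u i * v j) (s := Ico 0 δ) fun t ht => hdom t ht i j
  -- Used at `k = M` for the formula and at `k < n.choose 2` for the vanishing.
  have hderiv : ∀ k ≤ M, iteratedDerivWithin k (entrywiseDet f a u v) (Ico 0 δ) 0 =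
      k.factorial * ∑ l ∈ Finset.piAntidiag Finset.univ k with StrictMono l,
        (∏ j, iteratedDerivWithin (l j) f I a / (l j).factorial) *
          (Matrix.det (Matrix.of fun i j => u i ^ l j) *
            Matrix.det (Matrix.of fun i j => v i ^ l j)) := by
    intro k hk
    rw [entrywiseDet_eq_coeff_zero f I, hjet.iteratedDerivWithin_eq hs h0 hk]
    simp only [zero_mul, add_zero]
    rw [coeff_det_mk_pow (fun k => iteratedDerivWithin k f I a / k.factorial)]
  refine ⟨?_, ?_, fun i hi => ?_⟩
  · rw [entrywiseDet_eq_coeff_zero f I]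
    exact hjet.timesDiffWithinAt hs h0
  · rw [hderiv M le_rfl, Finset.mul_sum]
    have hsub : Finset.filter (fun l : Fin n → ℕ => StrictMono l)
        (Finset.piAntidiag Finset.univ M) ⊆ partitionTuples n M := by
      intro l hl
      rw [Finset.mem_filter] at hl
      exact Finset.mem_filter.2 ⟨hl.1, hl.2.monotone⟩
    rw [← Finset.sum_subset hsub]
    · refine Finset.sum_congr rfl fun l hl => ?_
      obtain ⟨hl, hmono⟩ := Finset.mem_filter.1 hl
      rw [det_pow_eq_vandermondeProd_mul_schurPoly u hmono,
        det_pow_eq_vandermondeProd_mul_schurPoly v hmono, Finset.prod_div_distrib]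
      -- This turns `M!` over the product of the `(l j)!` into the multinomial coefficient.
      have hspec := Nat.multinomial_spec (Finset.univ : Finset (Fin n)) l
      rw [(Finset.mem_piAntidiag.1 hl).1] at hspec
      have hpos : (∏ j, ((l j).factorial : ℝ)) ≠ 0 :=
        Finset.prod_ne_zero_iff.2 fun j _ => Nat.cast_ne_zero.2 (l j).factorial_ne_zero
      rw [← hspec]
      push_cast
      field_simp
    · intro l hl hnot
      have hmono : ¬ StrictMono l := fun h =>
        hnot (Finset.mem_filter.2 ⟨(Finset.mem_filter.1 hl).1, h⟩)
      simp [schurPoly, hmono]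
  -- The tuple `m` guarantees `n.choose 2 ≤ M`, so `hderiv` applies; its index set is empty at `i`.
  · rw [hderiv i (hi.le.trans (hM ▸ StrictMono.choose_two_le_sum hm)), Finset.sum_eq_zero, mul_zero]
    intro l hl
    obtain ⟨hl, hmono⟩ := Finset.mem_filter.1 hl
    have := StrictMono.choose_two_le_sum hmono
    have hsum : ∑ k, l k = i := (Finset.mem_piAntidiag.1 hl).1
    omega
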